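/- Let $p$ be a prime, let $G$ be a finite perfect group, and let $P$ be a nontrivial Sylow $p$-subgroup of $G$ such that $N_G(P)=P\,C_G(P)$. Let $\mathcal F=\mathcal F_P(G)$ be the fusion system of $G$ on $P$, i.e. the category whose objects are the subgroups of $P$ and whose morphisms $S\to T$ are the homomorphisms $s\mapsto gsg^{-1}$ with $g\in G$, $gSg^{-1}\le T$. A subgroup $Q\le P$ is called $\mathcal F$-essential if 1. $|N_P(R)|\le|N_P(Q)|$ for every $R\le P$ that is $\mathcal F$-isomorphic to $Q$; 2. $C_P(R)=Z(R)$ for every $R\le P$ that is $\mathcal F$-isomorphic to $Q$; 3. $X:=\operatorname{Out}_{\mathcal F}(Q)=\operatorname{Aut}_{\mathcal F}(Q)/\operatorname{Inn}(Q)$ has a strongly $p$-embedded subgroup, i.e. a subgroup $H$ with $p\mid|H|$, $p\nmid|X:H|>1$, and $p\nmid|H\cap xHx^{-1}|$ for all $x\in X\setminus H$. Then there are at least two conjugacy classes of $\mathcal F$-essential subgroups in $P$: there exist $\mathcal F$-essential subgroups $Q,R\le P$ that are not $\mathcal F$-isomorphic (equivalently, not conjugate in $G$; in particular, they are conjugate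 neither in $P$ nor under $\operatorname{Aut}_{\mathcal F}(P)$). -/

import Mathlib

/-- A fusion system on a group `P`: a category whose objects are the subgroups of `P`, whose
morphisms are injective group homomorphisms, which contains all maps induced by conjugation in `P`
(in particular all inclusions), and in which every morphism is an isomorphism in the category
onto its image, followed by an inclusion. (Saturation is not part of this structure.) -/
structure FusionSystem (P : Type*) [Group P] where
  /-- The set of morphisms from `S` to `T`. -/
  Hom : (S T : Subgroup P) → Set (S →* T)
  injective_of_mem : ∀ {S T : Subgroup P} {φ : S →* T}, φ ∈ Hom S T → Function.Injective φ
  mem_of_conj : ∀ {S T : Subgroup P} (φ : S →* T) (x : P),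
    (∀ s : S, (φ s : P) = x * (s : P) * x⁻¹) → φ ∈ Hom S T
  comp_mem : ∀ {S T U : Subgroup P} {φ : S →* T} {ψ : T →* U},
    φ ∈ Hom S T → ψ ∈ Hom T U → ψ.comp φ ∈ Hom S U
  iso_mem : ∀ {S T R : Subgroup P} {φ : S →* T}, φ ∈ Hom S T →
    ∀ e : S ≃* R, (∀ s : S, (e s : P) = (φ s : P)) →
      e.toMonoidHom ∈ Hom S R ∧ e.symm.toMonoidHom ∈ Hom R S

namespace FusionSystem

/-- The fusion system `F_P(G)` of a group `G` on a subgroup `P`: the morphisms `S → T` are the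
homomorphisms induced by conjugation with some element of `G`. -/
def ofGroup {G : Type*} [Group G] (P : Subgroup G) : FusionSystem P where
  Hom S T := {φ : S →* T | ∃ g : G, ∀ s : S, ((φ s : P) : G) = g * ((s : P) : G) * g⁻¹}
  injective_of_mem := by
    rintro S T φ ⟨g, hg⟩ a b hab
    have h := hg a
    rw [hab, hg b] at h
    exact Subtype.ext (Subtype.ext (mul_left_cancel (mul_right_cancel h)).symm)
  mem_of_conj := by
    intro S T φ x hx
    exact ⟨x, fun s => by rw [hx s]; rfl⟩
  comp_mem := by
    rintro S T U φ ψ ⟨g, hg⟩ ⟨h, hh⟩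
    refine ⟨h * g, fun s => ?_⟩
    rw [MonoidHom.comp_apply, hh, hg]
    group
  iso_mem := by
    rintro S T R φ ⟨g, hg⟩ e he
    refine ⟨⟨g, fun s => ?_⟩, ⟨g⁻¹, fun r => ?_⟩⟩
    · rw [← hg s, ← he s]; rfl
    · obtain ⟨s, rfl⟩ := e.surjective r
      have h1 : e.symm.toMonoidHom (e s) = s := e.symm_apply_apply s
      rw [h1, he s, hg s]
      group

variable {P : Type*} [Group P] (F : FusionSystem P)

/-- `S` and `T` are `F`-isomorphic (also called `F`-conjugate). By `iso_mem` the inverse of `e` is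
then a morphism of `F` as well. -/
def Isomorphic (S T : Subgroup P) : Prop :=
  ∃ e : S ≃* T, e.toMonoidHom ∈ F.Hom S T

/-- `Aut_F(Q)`, as a group of automorphisms of `Q`. -/
def autGroup (Q : Subgroup P) : Subgroup (MulAut Q) where
  carrier := {e | MulEquiv.toMonoidHom e ∈ F.Hom Q Q}
  mul_mem' := fun {_ _} ha hb => F.comp_mem hb ha
  one_mem' := F.mem_of_conj _ 1 (fun s => by simp)
  inv_mem' := fun {a} ha => (F.iso_mem ha a (fun _ => rfl)).2

/-- `Inn(Q)`, as a subgroup of `Aut_F(Q)` (it is contained in `Aut_F(Q)`). -/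
def innGroup (Q : Subgroup P) : Subgroup (F.autGroup Q) :=
  (MulAut.conj : Q →* MulAut Q).range.subgroupOf (F.autGroup Q)

theorem inn_le_autGroup (Q : Subgroup P) :
    (MulAut.conj : Q →* MulAut Q).range ≤ F.autGroup Q := by
  rintro _ ⟨q, rfl⟩
  exact F.mem_of_conj _ (q : P) (fun s => by simp)

instance innGroup_normal (Q : Subgroup P) : (F.innGroup Q).Normal := by
  refine ⟨?_⟩
  rintro ⟨a, ha⟩ ⟨q, hq⟩ ⟨b, hb⟩
  refine ⟨b q, ?_⟩
  change MulAut.conj q = a at hq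
  change MulAut.conj (b q) = b * a * b⁻¹
  rw [← hq]
  ext x
  simp [MulAut.mul_apply]

/-- `Out_F(Q) = Aut_F(Q) / Inn(Q)`. -/
abbrev Out (Q : Subgroup P) : Type _ := F.autGroup Q ⧸ F.innGroup Q

/-- `H` is a strongly `p`-embedded subgroup of `X`. -/
def StronglyEmbedded (p : ℕ) {X : Type*} [Group X] (H : Subgroup X) : Prop :=
  p ∣ Nat.card H ∧ ¬ p ∣ H.index ∧ 1 < H.index ∧
    ∀ x : X, x ∉ H → ¬ p ∣ Nat.card (H ⊓ H.map (MulAut.conj x).toMonoidHom : Subgroup X)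

/-- `Q` is fully `F`-normalized. -/
def FullyNormalized (Q : Subgroup P) : Prop :=
  ∀ R : Subgroup P, F.Isomorphic R Q →
    Nat.card (Subgroup.normalizer (R : Set P)) ≤ Nat.card (Subgroup.normalizer (Q : Set P))

/-- `Q` is `F`-centric: `C_P(R) = Z(R)` for all `R` that are `F`-isomorphic to `Q`. -/
def Centric (Q : Subgroup P) : Prop :=
  ∀ R : Subgroup P, F.Isomorphic R Q →
    Subgroup.centralizer (R : Set P) = (Subgroup.center R).map R.subtype

/-- `Q` is `F`-essential (with respect to the prime `p`). -/
def Essential (p : ℕ) (Q : Subgroup P) : Prop :=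
  F.FullyNormalized Q ∧ F.Centric Q ∧ ∃ H : Subgroup (F.Out Q), StronglyEmbedded p H

end FusionSystem

/-! Suppose that all essential subgroups are `F`-isomorphic. The condition `N_G(P) = P C_G(P)` says
that `Out_F(P)` is trivial; so `P` is not essential, and on `P` the group `N_G(P)` induces only
inner automorphisms.

Alperin's fusion theorem is proved in the form: a property of conjugation maps that is stable under
restriction, composition and inversion, and holds for centralizing elements, for `N_G(P)` on `P` and
for `N_G(Q)` on each essential `Q`, holds for every conjugation map between subgroups of `P`
(`ConjClosed.of_essential`). It is used twice. First, the essential subgroups, all of the same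
order, turn out to be conjugate in `P` itself (`exists_conj_smul_eq_of_isomorphic`). Hence a maximal
subgroup `M` of `P` above one of them, being normal, contains them all. Second, every commutator
`⁅s, g⁆` with `s` and `g s g⁻¹` in `P` lies in `M`. So the focal subgroup, which is `P ∩ G' = P` as
`G` is perfect, lies in `M < P`, a contradiction. -/

open scoped Pointwise

/-! ### Conjugation of subgroups, `p`-subgroups and strongly embedded subgroups. -/

namespace Subgroup

variable {G : Type*} [Group G]

theorem mem_conj_smul {S : Subgroup G} {g x : G} :
    x ∈ MulAut.conj g • S ↔ g⁻¹ * x * g ∈ S := by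
  rw [mem_pointwise_smul_iff_inv_smul_mem, ← map_inv, MulAut.smul_def, MulAut.conj_apply, inv_inv]

theorem conj_mem_conj_smul {S : Subgroup G} {g x : G} (hx : x ∈ S) :
    g * x * g⁻¹ ∈ MulAut.conj g • S :=
  smul_mem_pointwise_smul x (MulAut.conj g) S hx

theorem conj_smul_eq_map (S : Subgroup G) (g : G) :
    MulAut.conj g • S = S.map (MulAut.conj g).toMonoidHom := rfl

theorem conj_mul_smul (S : Subgroup G) (g h : G) :
    MulAut.conj (g * h) • S = MulAut.conj g • MulAut.conj h • S := by
  rw [map_mul, mul_smul]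

theorem conj_inv_smul_smul (S : Subgroup G) (g : G) :
    MulAut.conj g⁻¹ • MulAut.conj g • S = S := by
  rw [map_inv, inv_smul_smul]

theorem conj_smul_mono {S T : Subgroup G} (h : S ≤ T) (g : G) :
    MulAut.conj g • S ≤ MulAut.conj g • T :=
  pointwise_smul_le_pointwise_smul_iff.mpr h

theorem card_conj_smul (S : Subgroup G) (g : G) :
    Nat.card (MulAut.conj g • S : Subgroup G) = Nat.card S :=
  (Nat.card_congr (equivSMul (MulAut.conj g) S).toEquiv).symm

theorem conj_smul_eq_self_iff {S : Subgroup G} {g : G} :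
    MulAut.conj g • S = S ↔ g ∈ normalizer (S : Set G) :=
  mem_normalizer_iff_map_conj_eq.symm

theorem conj_smul_eq_self_of_mem_centralizer {S : Subgroup G} {g : G}
    (hg : g ∈ centralizer (S : Set G)) : MulAut.conj g • S = S :=
  conj_smul_eq_self_iff.mpr (centralizer_le_normalizer _ hg)

theorem conj_smul_normalizer (S : Subgroup G) (g : G) :
    MulAut.conj g • normalizer (S : Set G) =
      normalizer ((MulAut.conj g • S : Subgroup G) : Set G) :=
  map_equiv_normalizer_eq S (MulAut.conj g)

theorem conj_smul_centralizer (S : Subgroup G) (g : G) :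
    MulAut.conj g • centralizer (S : Set G) =
      centralizer ((MulAut.conj g • S : Subgroup G) : Set G) := by
  ext x
  simp only [mem_conj_smul, mem_centralizer_iff, SetLike.mem_coe]
  constructor
  · intro h y hy
    have := h _ hy
    have h2 : g * (g⁻¹ * y * g * (g⁻¹ * x * g)) * g⁻¹ =
      g * (g⁻¹ * x * g * (g⁻¹ * y * g)) * g⁻¹ := by rw [this]
    simpa [mul_assoc] using h2
  · intro h y hy
    have := h (g * y * g⁻¹) (by simpa [mul_assoc] using hy)
    have h2 : g⁻¹ * (g * y * g⁻¹ * x) * g = g⁻¹ * (x * (g * y * g⁻¹)) * g := by rw [this]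
    simpa [mul_assoc] using h2

theorem isPGroup_conj_smul {p : ℕ} {S : Subgroup G} (h : IsPGroup p S) (g : G) :
    IsPGroup p (MulAut.conj g • S : Subgroup G) := h.map _

variable {p : ℕ} [Fact p.Prime]

/-- A `p`-subgroup `T` of `K` of the largest possible order contains a `K`-conjugate of every
`p`-subgroup of `K`. -/
theorem exists_conj_smul_le_of_card_le [Finite G] {K T B : Subgroup G} (hT : IsPGroup p T)
    (hTK : T ≤ K) (hB : IsPGroup p B) (hBK : B ≤ K)
    (hmax : ∀ T' ≤ K, IsPGroup p T' → Nat.card T' ≤ Nat.card T) :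
    ∃ k ∈ K, MulAut.conj k • B ≤ T := by
  obtain ⟨T₁, hT₁⟩ := (hT.comap_subtype (K := K)).exists_le_sylow
  obtain ⟨B₁, hB₁⟩ := (hB.comap_subtype (K := K)).exists_le_sylow
  obtain ⟨k, hk⟩ := MulAction.exists_smul_eq K B₁ T₁
  have hTle : T ≤ (T₁ : Subgroup K).map K.subtype := by
    intro t ht
    exact ⟨⟨t, hTK ht⟩, hT₁ ht, rfl⟩
  -- Maximality of the order makes `T` a Sylow subgroup of `K`.
  have hTeq : T = (T₁ : Subgroup K).map K.subtype :=
    eq_of_le_of_card_ge hTle (hmax _ (map_subtype_le _) (T₁.2.map _))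
  refine ⟨k, k.2, ?_⟩
  intro x hx
  rw [mem_conj_smul] at hx
  rw [hTeq]
  have hxK : x ∈ K := by
    have := K.mul_mem (K.mul_mem k.2 (hBK hx)) (K.inv_mem k.2)
    simpa [mul_assoc] using this
  refine ⟨⟨x, hxK⟩, ?_, rfl⟩
  rw [← hk, Sylow.coe_subgroup_smul]
  change _ ∈ MulAut.conj k • (B₁ : Subgroup K)
  rw [mem_conj_smul]
  exact hB₁ hx

theorem _root_.IsPGroup.card_le_card_sylow [Finite G] {S : Subgroup G} (hS : IsPGroup p S)
    (P : Sylow p G) : Nat.card S ≤ Nat.card P := by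
  obtain ⟨T, hT⟩ := hS.exists_le_sylow
  refine (card_le_of_le hT).trans (le_of_eq ?_)
  rw [T.card_eq_multiplicity, P.card_eq_multiplicity]

/-- Normalizers grow in `p`-groups because these are nilpotent. -/
theorem lt_inf_normalizer_of_lt [Finite G] {P R : Subgroup G} (hP : IsPGroup p P) (h : R < P) :
    R < P ⊓ normalizer (R : Set G) := by
  refine lt_of_le_of_ne (le_inf h.le le_normalizer) fun heq => ?_
  have hnil := hP.isNilpotent
  have hlt : R.subgroupOf P < ⊤ := by
    rw [lt_top_iff_ne_top, Ne, subgroupOf_eq_top]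
    exact not_le_of_gt h
  obtain ⟨x, hx, hxR⟩ := SetLike.exists_of_lt (Group.normalizerCondition_of_isNilpotent _ hlt)
  apply hxR
  change (x : G) ∈ R
  rw [heq]
  refine ⟨x.2, ?_⟩
  change (x : G) ∈ normalizer (R : Set G)
  rw [mem_normalizer_iff]
  intro y
  rw [mem_normalizer_iff] at hx
  constructor
  · intro hy
    exact (hx ⟨y, h.le hy⟩).mp hy
  · intro hy
    have hyP : y ∈ P := by
      have := P.mul_mem (P.mul_mem (P.inv_mem x.2) (h.le hy)) x.2
      simpa [mul_assoc] using this
    exact (hx ⟨y, hyP⟩).mpr hy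

/-- If `K ∩ nKn⁻¹` has an element of order `p` modulo the kernel, it lifts to a `p`-element `b`.
Sylow's theorem in `K` moves both `b` and `n⁻¹bn` into `T`, so `hconj` applies to the transporting
element and puts `n` into `K`. -/
theorem stronglyEmbedded_map {N X : Type*} [Group N] [Finite N] [Group X] (T : Sylow p N)
    {K : Subgroup N} (hTK : T ≤ K) (hK : K ≠ ⊤) (f : N →* X) (hf : Function.Surjective f)
    (hker : f.ker ≤ K) (hT : ¬ (T : Subgroup N) ≤ f.ker)
    (hconj : ∀ A : Subgroup N, A ≤ T → ¬ A ≤ f.ker → ∀ m : N, MulAut.conj m • A ≤ T → m ∈ K) :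
    FusionSystem.StronglyEmbedded p (K.map f) := by
  have hp : p.Prime := Fact.out
  have hX : Finite X := Finite.of_surjective f hf
  refine ⟨?_, ?_, ?_, ?_⟩
  · refine dvd_trans ?_ (card_dvd_of_le (map_mono (f := f) hTK))
    refine (T.2.map f).card_eq_or_dvd.resolve_left fun h => hT ?_
    rw [card_eq_one] at h
    exact (map_eq_bot_iff _).mp h
  · rw [index_map_eq _ hf hker]
    exact fun h => T.not_dvd_index (h.trans (index_dvd_of_le hTK))
  · rw [index_map_eq _ hf hker]
    have h0 : K.index ≠ 0 := index_ne_zero_of_finite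
    have h1 : K.index ≠ 1 := by rwa [Ne, index_eq_one]
    omega
  · intro x hx hdvd
    obtain ⟨n, rfl⟩ := hf x
    have hn : n ∉ K := fun h => hx (mem_map_of_mem f h)
    have hmem : ∀ b, f b ∈ K.map f → b ∈ K := by
      rintro b ⟨k, hk, hkb⟩
      have : k⁻¹ * b ∈ f.ker := by rw [MonoidHom.mem_ker, map_mul, map_inv, hkb, inv_mul_cancel]
      simpa using K.mul_mem hk (hker this)
    obtain ⟨⟨y, hyH'⟩, hy⟩ := exists_prime_orderOf_dvd_card' p hdvd
    rw [orderOf_mk] at hy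
    obtain ⟨hyH, hyx⟩ := mem_inf.mp hyH'
    obtain ⟨b₀, rfl⟩ := hf y
    -- Passing to the `p`-part: `b₀ ^ m` is a `p`-element, and its image is nontrivial because `f
    -- b₀` has order `p` and `p ∤ m`.
    obtain ⟨k, m, hm, hkm⟩ := Nat.exists_eq_pow_mul_and_not_dvd (orderOf_pos b₀).ne' p hp.ne_one
    have hb : (b₀ ^ m) ^ p ^ k = 1 := by rw [← pow_mul, mul_comm, ← hkm, pow_orderOf_eq_one]
    have hfb : f (b₀ ^ m) ≠ 1 := by
      rw [map_pow]
      intro h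
      exact hm (hy ▸ orderOf_dvd_of_pow_eq_one h)
    set b := b₀ ^ m with hbdef
    have hbK : b ∈ K := hmem _ (by rw [hbdef, map_pow]; exact pow_mem hyH m)
    have hbn : n⁻¹ * b * n ∈ K := by
      apply hmem
      have : f b ∈ (K.map f).map (MulAut.conj (f n)).toMonoidHom := by
        rw [hbdef, map_pow]; exact pow_mem hyx m
      rw [← conj_smul_eq_map, mem_conj_smul] at this
      simpa using this
    have hB : IsPGroup p (zpowers b) := by
      refine IsPGroup.of_card_dvd_pow (n := k) ?_
      rw [Nat.card_zpowers]
      exact orderOf_dvd_of_pow_eq_one hb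
    have hmax : ∀ T' ≤ K, IsPGroup p T' → Nat.card T' ≤ Nat.card T :=
      fun _ _ hT' => hT'.card_le_card_sylow T
    obtain ⟨k₁, hk₁, hle₁⟩ := exists_conj_smul_le_of_card_le T.2 hTK hB
      (zpowers_le.mpr hbK) hmax
    obtain ⟨k₂, hk₂, hle₂⟩ := exists_conj_smul_le_of_card_le T.2 hTK
      (isPGroup_conj_smul hB n⁻¹) (by
        intro x hx
        rw [mem_conj_smul, inv_inv, mem_zpowers_iff] at hx
        obtain ⟨j, hj⟩ := hx
        have : x = (n⁻¹ * b * n) ^ j := by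
          have h1 := conj_zpow (i := j) (a := n⁻¹) (b := b)
          rw [inv_inv] at h1
          rw [h1, hj]
          group
        rw [this]
        exact zpow_mem hbn j) hmax
    have := hconj (MulAut.conj k₁ • zpowers b) hle₁ (by
      intro h
      have h1 := h (conj_mem_conj_smul (g := k₁) (mem_zpowers b))
      rw [MonoidHom.mem_ker, map_mul, map_mul, map_inv] at h1
      exact hfb (conj_eq_one_iff.mp h1)) (k₂ * n⁻¹ * k₁⁻¹) (by
        rw [conj_mul_smul, conj_inv_smul_smul, conj_mul_smul]
        exact hle₂)
    apply hn
    have h2 := K.mul_mem (K.mul_mem (K.inv_mem hk₂) this) hk₁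
    have h3 : n⁻¹ ∈ K := by simpa [mul_assoc] using h2
    simpa using K.inv_mem h3

end Subgroup

/-! ### The fusion system of a group in terms of subgroups of `G`. -/

namespace FusionSystem

open Subgroup

variable {G : Type*} [Group G] {P : Subgroup G}

theorem map_subtype_subgroupOf {R : Subgroup G} (h : R ≤ P) : (R.subgroupOf P).map P.subtype = R :=
  map_subgroupOf_eq_of_le h

theorem ofGroup_isomorphic_iff {S T : Subgroup P} :
    (ofGroup P).Isomorphic S T ↔ ∃ g : G, MulAut.conj g • S.map P.subtype = T.map P.subtype := by
  constructor
  · rintro ⟨e, g, hg⟩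
    refine ⟨g, ?_⟩
    ext x
    rw [mem_conj_smul]
    constructor
    · rintro ⟨s, hs, hsx⟩
      refine ⟨e ⟨s, hs⟩, (e ⟨s, hs⟩).2, ?_⟩
      refine (hg ⟨s, hs⟩).trans ?_
      change g * P.subtype s * g⁻¹ = x
      rw [hsx]
      group
    · rintro ⟨t, ht, rfl⟩
      obtain ⟨s, hs⟩ := e.surjective ⟨t, ht⟩
      refine ⟨s, s.2, ?_⟩
      have := hg s
      change (((e s : T) : P) : G) = _ at this
      rw [hs] at this
      change ((s : P) : G) = g⁻¹ * (t : G) * g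
      rw [this]
      group
  · rintro ⟨g, hg⟩
    let e₁ := S.equivMapOfInjective P.subtype P.subtype_injective
    let e₂ := equivSMul (MulAut.conj g) (S.map P.subtype)
    let e₃ := T.equivMapOfInjective P.subtype P.subtype_injective
    refine ⟨e₁.trans (e₂.trans ((MulEquiv.subgroupCongr hg).trans e₃.symm)), g, fun s => ?_⟩
    have h : ∀ y, (((e₃.symm y : T) : P) : G) = y := fun y => by
      obtain ⟨t, rfl⟩ := e₃.surjective y
      rw [e₃.symm_apply_apply]
      rfl
    refine (h _).trans ?_
    rfl

theorem map_subtype_normalizer (Q : Subgroup P) :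
    (normalizer (Q : Set P)).map P.subtype =
      P ⊓ normalizer ((Q.map P.subtype : Subgroup G) : Set G) := by
  have hQ : ∀ y : P, (y : G) ∈ Q.map P.subtype ↔ y ∈ Q := fun y =>
    mem_map_iff_mem P.subtype_injective
  ext x
  rw [mem_inf]
  constructor
  · rintro ⟨n, hn, rfl⟩
    refine ⟨n.2, ?_⟩
    rw [← conj_smul_eq_self_iff]
    rw [SetLike.mem_coe, ← conj_smul_eq_self_iff] at hn
    ext x
    rw [mem_conj_smul]
    constructor
    · rintro ⟨s, hs, hsx⟩
      refine ⟨n * s * n⁻¹, hn ▸ conj_mem_conj_smul hs, ?_⟩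
      rw [map_mul, map_mul, hsx, map_inv]
      group
    · rintro ⟨s, hs, rfl⟩
      refine ⟨n⁻¹ * s * n, mem_conj_smul.mp (hn.symm ▸ hs), ?_⟩
      simp
  · rintro ⟨hx, hn⟩
    refine ⟨⟨x, hx⟩, ?_, rfl⟩
    rw [SetLike.mem_coe, mem_normalizer_iff]
    rw [mem_normalizer_iff] at hn
    intro y
    rw [← hQ, ← hQ]
    exact hn y

theorem card_normalizer_map_subtype (Q : Subgroup P) :
    Nat.card (normalizer (Q : Set P)) =
      Nat.card (P ⊓ normalizer ((Q.map P.subtype : Subgroup G) : Set G) : Subgroup G) := by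
  rw [← map_subtype_normalizer, card_map_of_injective P.subtype_injective]

theorem ofGroup_fullyNormalized {Q : Subgroup P}
    (h : ∀ g : G, MulAut.conj g • Q.map P.subtype ≤ P →
      Nat.card (P ⊓ normalizer ((MulAut.conj g • Q.map P.subtype : Subgroup G) : Set G) :
        Subgroup G) ≤
      Nat.card (P ⊓ normalizer ((Q.map P.subtype : Subgroup G) : Set G) : Subgroup G)) :
    (ofGroup P).FullyNormalized Q := by
  intro R hR
  obtain ⟨g, hg⟩ := ofGroup_isomorphic_iff.mp hR
  rw [card_normalizer_map_subtype, card_normalizer_map_subtype]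
  have hR' : MulAut.conj g⁻¹ • Q.map P.subtype = R.map P.subtype := by
    rw [← hg, conj_inv_smul_smul]
  rw [← hR']
  exact h g⁻¹ (hR' ▸ map_subtype_le R)

theorem ofGroup_centric {Q : Subgroup P}
    (h : ∀ g : G, MulAut.conj g • Q.map P.subtype ≤ P →
      P ⊓ centralizer ((MulAut.conj g • Q.map P.subtype : Subgroup G) : Set G) ≤
        MulAut.conj g • Q.map P.subtype) :
    (ofGroup P).Centric Q := by
  intro R hR
  obtain ⟨g, hg⟩ := ofGroup_isomorphic_iff.mp hR
  have hR' : MulAut.conj g⁻¹ • Q.map P.subtype = R.map P.subtype := by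
    rw [← hg, conj_inv_smul_smul]
  have hc := h g⁻¹ (hR' ▸ map_subtype_le R)
  rw [hR'] at hc
  ext x
  constructor
  · intro hx
    have hxR : x ∈ R := by
      refine (mem_map_iff_mem P.subtype_injective).mp (hc ⟨x.2, ?_⟩)
      change (x : G) ∈ centralizer _
      rw [mem_centralizer_iff]
      rintro _ ⟨r, hr, rfl⟩
      exact congrArg P.subtype (mem_centralizer_iff.mp hx r hr)
    refine ⟨⟨x, hxR⟩, ?_, rfl⟩
    rw [SetLike.mem_coe, mem_center_iff]
    intro r
    exact Subtype.ext (mem_centralizer_iff.mp hx r r.2)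
  · rintro ⟨z, hz, rfl⟩
    rw [mem_centralizer_iff]
    intro r hr
    exact congrArg R.subtype (mem_center_iff.mp hz ⟨r, hr⟩)

/-- The action of `N_G(Q)` on `Q` by conjugation, as a homomorphism to `Aut_F(Q)`. -/
noncomputable def normalizerToAut (Q : Subgroup P) :
    normalizer ((Q.map P.subtype : Subgroup G) : Set G) →* (ofGroup P).autGroup Q :=
  ((MulAut.congr (Q.equivMapOfInjective P.subtype P.subtype_injective).symm).toMonoidHom.comp
    (Q.map P.subtype).normalizerMonoidHom).codRestrict _ (fun n => by
      refine ⟨n, fun s => ?_⟩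
      exact congrArg Subtype.val
        ((Q.equivMapOfInjective P.subtype P.subtype_injective).apply_symm_apply _))

theorem normalizerToAut_apply (Q : Subgroup P)
    (n : normalizer ((Q.map P.subtype : Subgroup G) : Set G)) (q : Q) :
    ((((normalizerToAut Q n : MulAut Q) q : Q) : P) : G) = n * ((q : P) : G) * (n : G)⁻¹ :=
  congrArg Subtype.val ((Q.equivMapOfInjective P.subtype P.subtype_injective).apply_symm_apply _)

/-- The natural homomorphism from `N_G(Q)` to `Out_F(Q)`. -/
noncomputable def normalizerToOut (Q : Subgroup P) :
    normalizer ((Q.map P.subtype : Subgroup G) : Set G) →* (ofGroup P).Out Q :=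
  (QuotientGroup.mk' _).comp (normalizerToAut Q)

theorem normalizerToOut_surjective (Q : Subgroup P) :
    Function.Surjective (normalizerToOut Q) := by
  refine (QuotientGroup.mk'_surjective _).comp ?_
  rintro ⟨a, g, hg⟩
  have hn : g ∈ normalizer ((Q.map P.subtype : Subgroup G) : Set G) := by
    rw [← conj_smul_eq_self_iff]
    refine SetLike.ext fun x => ?_
    rw [mem_conj_smul]
    constructor
    · rintro ⟨s, hs, hsx⟩
      refine ⟨a ⟨s, hs⟩, (a ⟨s, hs⟩).2, (hg ⟨s, hs⟩).trans ?_⟩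
      change g * P.subtype s * g⁻¹ = x
      rw [hsx]
      group
    · rintro ⟨t, ht, rfl⟩
      obtain ⟨s, hs⟩ := a.surjective ⟨t, ht⟩
      refine ⟨s, s.2, ?_⟩
      have := hg s
      change (((a s : Q) : P) : G) = _ at this
      rw [hs] at this
      change ((s : P) : G) = g⁻¹ * (t : G) * g
      rw [this]
      group
  refine ⟨⟨g, hn⟩, Subtype.ext (MulEquiv.ext fun q => Subtype.ext (Subtype.ext ?_))⟩
  rw [normalizerToAut_apply]
  exact (hg q).symm

/-- The kernel is `Q C_G(Q)`: `n` acts on `Q` as `q` does exactly when `n * q⁻¹` centralizes `Q`. -/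
theorem mem_ker_normalizerToOut {Q : Subgroup P}
    {n : normalizer ((Q.map P.subtype : Subgroup G) : Set G)} :
    n ∈ (normalizerToOut Q).ker ↔ ∃ q ∈ Q.map P.subtype,
      (n : G) * q⁻¹ ∈ centralizer ((Q.map P.subtype : Subgroup G) : Set G) := by
  have key : ∀ q : Q, MulAut.conj q = (normalizerToAut Q n : MulAut Q) ↔
      (n : G) * ((q : P) : G)⁻¹ ∈ centralizer ((Q.map P.subtype : Subgroup G) : Set G) := by
    intro q
    rw [mem_centralizer_iff, MulEquiv.ext_iff]
    have h1 : ∀ s : Q, MulAut.conj q s = (normalizerToAut Q n : MulAut Q) s ↔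
        ((q : P) : G) * ((s : P) : G) * ((q : P) : G)⁻¹ = n * ((s : P) : G) * (n : G)⁻¹ := by
      intro s
      rw [← normalizerToAut_apply, Subtype.ext_iff, Subtype.ext_iff]
      rfl
    simp only [h1]
    constructor
    · rintro h _ ⟨s, hs, rfl⟩
      have := h (q⁻¹ * ⟨s, hs⟩ * q)
      simp only [coe_mul, coe_inv] at this
      have h2 : (s : G) = n * (((q : P) : G)⁻¹ * (s : G) * ((q : P) : G)) * (n : G)⁻¹ := by
        rw [← this]; group
      change (s : G) * _ = _ * (s : G)
      nth_rw 1 [h2]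
      group
    · intro h s
      have := h _ (mem_map_of_mem P.subtype (q * s * q⁻¹).2)
      simp only [coe_mul, coe_inv, subtype_apply] at this
      rw [← mul_left_inj ((n : G) * ((q : P) : G)⁻¹), this]
      group
  rw [normalizerToOut, MonoidHom.mem_ker, MonoidHom.comp_apply, QuotientGroup.mk'_apply,
    QuotientGroup.eq_one_iff]
  constructor
  · rintro ⟨q, hq⟩
    exact ⟨_, mem_map_of_mem P.subtype q.2, (key q).mp hq⟩
  · rintro ⟨_, ⟨q, hq, rfl⟩, hc⟩
    exact ⟨⟨q, hq⟩, (key ⟨q, hq⟩).mpr hc⟩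

end FusionSystem

/-! ### Alperin's fusion theorem. -/

namespace FusionSystem

open Subgroup

variable {G : Type*} [Group G] {p : ℕ} [Fact p.Prime]

/-- A property of conjugation maps `S → gSg⁻¹` between subgroups of `P` that is inherited by
restrictions, composites and inverses, and holds for the identity maps and for the
automorphisms of `P` induced by `N_G(P)`. -/
structure ConjClosed (P : Subgroup G) (Good : Subgroup G → G → Prop) : Prop where
  mono : ∀ {S T : Subgroup G} {g : G}, T ≤ S → Good S g → Good T g
  mul : ∀ {S : Subgroup G} {g h : G}, Good S g → Good (MulAut.conj g • S) h → Good S (h * g)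
  inv : ∀ {S : Subgroup G} {g : G}, Good S g → Good (MulAut.conj g • S) g⁻¹
  of_mem_centralizer : ∀ {S : Subgroup G} {g : G}, S ≤ P → g ∈ centralizer (S : Set G) → Good S g
  of_mem_normalizer : ∀ {g : G}, g ∈ normalizer (P : Set G) → Good P g

variable {Good : Subgroup G → G → Prop}

namespace ConjClosed

variable {P R : Subgroup G}

theorem of_mem (h : ConjClosed P Good) (hR : R ≤ P) {g : G} (hg : g ∈ P) : Good R g :=
  h.mono hR (h.of_mem_normalizer (le_normalizer hg))

theorem mul_of_normalizer (h : ConjClosed P Good) {a b : G}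
    (hb : b ∈ normalizer (R : Set G)) (hgb : Good R b) (hga : Good R a) : Good R (a * b) :=
  h.mul hgb ((conj_smul_eq_self_iff.mpr hb).symm ▸ hga)

/-- The elements of `N_G(R)` whose action on `R` has a given property. -/
def stabilizer (h : ConjClosed P Good) (hR : R ≤ P) : Subgroup (normalizer (R : Set G)) where
  carrier := {n | Good R n}
  mul_mem' := fun {_ b} ha hb => h.mul_of_normalizer b.2 hb ha
  one_mem' := h.of_mem_centralizer hR (one_mem _)
  inv_mem' := fun {a} ha => by
    have := h.inv ha
    rwa [conj_smul_eq_self_iff.mpr a.2] at this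

end ConjClosed

variable [Finite G]

/-- Makes `N_P(R)` Sylow in `N_G(R)` for fully normalized `R`: the `p`-group `TR` has a conjugate in
`P`, which takes `T` into the normalizer in `P` of a conjugate of `R`. -/
theorem card_le_card_inf_normalizer (P : Sylow p G) {R : Subgroup G} (hR : R ≤ P)
    (hfn : ∀ g : G, MulAut.conj g • R ≤ P →
      Nat.card (P ⊓ normalizer ((MulAut.conj g • R : Subgroup G) : Set G) : Subgroup G) ≤
      Nat.card (P ⊓ normalizer (R : Set G) : Subgroup G))
    {T : Subgroup G} (hT : T ≤ normalizer (R : Set G)) (hTp : IsPGroup p T) :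
    Nat.card T ≤ Nat.card (P ⊓ normalizer (R : Set G) : Subgroup G) := by
  have hsup : IsPGroup p (T ⊔ R : Subgroup G) := hTp.to_sup_of_normal_right' (P.2.to_le hR) hT
  obtain ⟨g, -, hg⟩ := exists_conj_smul_le_of_card_le P.2 le_top hsup le_top
    (fun T' _ hT' => hT'.card_le_card_sylow P)
  rw [smul_sup] at hg
  refine le_trans ?_ (hfn g (le_sup_right.trans hg))
  rw [← card_conj_smul T g, ← conj_smul_normalizer]
  exact card_le_of_le (le_inf (le_sup_left.trans hg) (conj_smul_mono hT g))

/-- A Frattini argument: `A = C_P(R)` is Sylow in `C_G(R)`, so `n` can be corrected by some `c` in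
`C_G(R)` until it normalizes `A`. Then `c * n` acts on `RA > R`, where induction applies. -/
theorem ConjClosed.of_centralizer_not_le (P : Sylow p G) (h : ConjClosed (P : Subgroup G) Good)
    {R : Subgroup G} (hR : R ≤ P)
    (hcard : ∀ T ≤ normalizer (R : Set G), IsPGroup p T →
      Nat.card T ≤ Nat.card (P ⊓ normalizer (R : Set G) : Subgroup G))
    (ih : ∀ S g, R < S → S ≤ P → MulAut.conj g • S ≤ (P : Subgroup G) → Good S g)
    (hc : ¬ (P ⊓ centralizer (R : Set G) : Subgroup G) ≤ R)
    {n : G} (hn : n ∈ normalizer (R : Set G)) : Good R n := by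
  set A : Subgroup G := P ⊓ centralizer (R : Set G) with hA
  have hAp : IsPGroup p A := P.2.to_inf_left
  have hCN : centralizer (R : Set G) ≤ normalizer (R : Set G) := centralizer_le_normalizer _
  have hCn : ∀ m ∈ normalizer (R : Set G),
      MulAut.conj m • centralizer (R : Set G) = centralizer (R : Set G) := fun m hm => by
    rw [conj_smul_centralizer, conj_smul_eq_self_iff.mpr hm]
  have hmax : ∀ T' ≤ centralizer (R : Set G), IsPGroup p T' → Nat.card T' ≤ Nat.card A := by
    intro T' hT' hT'p
    obtain ⟨m, hm, hle⟩ := exists_conj_smul_le_of_card_le P.2.to_inf_left inf_le_right hT'p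
      (hT'.trans hCN) hcard
    rw [← card_conj_smul T' m]
    exact card_le_of_le (le_inf (hle.trans inf_le_left)
      ((conj_smul_mono hT' m).trans (hCn m hm).le))
  obtain ⟨c, hc', hle⟩ := exists_conj_smul_le_of_card_le hAp inf_le_right
    (isPGroup_conj_smul hAp n) ((conj_smul_mono inf_le_right n).trans (hCn n hn).le) hmax
  rw [← conj_mul_smul] at hle
  have hm : c * n ∈ normalizer (R : Set G) := mul_mem (hCN hc') hn
  have hgood : Good (R ⊔ A) (c * n) := by
    refine ih _ _ (left_lt_sup.mpr hc) (sup_le hR inf_le_left) ?_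
    rw [smul_sup, conj_smul_eq_self_iff.mpr hm]
    exact sup_le hR (hle.trans inf_le_left)
  have := h.mul_of_normalizer hm (h.mono le_sup_left hgood)
    (h.of_mem_centralizer hR (inv_mem hc'))
  simpa using this

/-- If the good elements formed a proper subgroup of `N_G(R)`, its image in `Out_F(Q)` would be
strongly embedded: an element carrying a `p`-subgroup `A` of `N_P(R)` with `A ≰ R` into `P` extends
to `RA > R`, so it is good by induction. -/
theorem ConjClosed.of_not_essential (P : Sylow p G) (h : ConjClosed (P : Subgroup G) Good)
    {Q : Subgroup (P : Subgroup G)} (hlt : Q.map (P : Subgroup G).subtype < P)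
    (hess : ¬ (ofGroup (P : Subgroup G)).Essential p Q)
    (hfn : ∀ g : G, MulAut.conj g • Q.map (P : Subgroup G).subtype ≤ (P : Subgroup G) →
      Nat.card (P ⊓ normalizer ((MulAut.conj g • Q.map (P : Subgroup G).subtype : Subgroup G) :
        Set G) : Subgroup G) ≤
      Nat.card (P ⊓ normalizer ((Q.map (P : Subgroup G).subtype : Subgroup G) : Set G) :
        Subgroup G))
    (hcen : ∀ g : G, MulAut.conj g • Q.map (P : Subgroup G).subtype ≤ (P : Subgroup G) →
      (P ⊓ centralizer ((MulAut.conj g • Q.map (P : Subgroup G).subtype : Subgroup G) : Set G) :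
        Subgroup G) ≤ MulAut.conj g • Q.map (P : Subgroup G).subtype)
    (ih : ∀ S g, Q.map (P : Subgroup G).subtype < S → S ≤ P →
      MulAut.conj g • S ≤ (P : Subgroup G) → Good S g)
    {n : G} (hn : n ∈ normalizer ((Q.map (P : Subgroup G).subtype : Subgroup G) : Set G)) :
    Good (Q.map (P : Subgroup G).subtype) n := by
  have hcard := fun T => card_le_card_inf_normalizer (T := T) P hlt.le hfn
  set R := Q.map (P : Subgroup G).subtype with hRdef
  obtain ⟨f, hsurj, hker⟩ : ∃ f : normalizer (R : Set G) →* (ofGroup (P : Subgroup G)).Out Q,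
      Function.Surjective f ∧ ∀ n : normalizer (R : Set G), n ∈ f.ker ↔
        ∃ q ∈ R, (n : G) * q⁻¹ ∈ centralizer (R : Set G) :=
    ⟨_, normalizerToOut_surjective Q, fun _ => mem_ker_normalizerToOut⟩
  have hRP : R ≤ P := hlt.le
  have hlt' := lt_inf_normalizer_of_lt P.2 hlt
  by_contra hbad
  apply hess
  refine ⟨ofGroup_fullyNormalized hfn, ofGroup_centric hcen,
    (h.stabilizer hRP).map f, ?_⟩
  let T : Sylow p (normalizer (R : Set G)) :=
    { toSubgroup := (P : Subgroup G).subgroupOf (normalizer (R : Set G))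
      isPGroup' := P.2.comap_subtype
      is_maximal' := by
        intro T' hT' hle
        refine (eq_of_le_of_card_ge hle ?_).symm
        have := hcard (T'.map (normalizer (R : Set G)).subtype) (map_subtype_le _) (hT'.map _)
        rwa [card_map_of_injective (subtype_injective _), ← subgroupOf_map_subtype,
          card_map_of_injective (subtype_injective _)] at this }
  have hRker : ∀ r : normalizer (R : Set G), (r : G) ∈ R → r ∈ f.ker := fun r hr =>
    (hker _).mpr ⟨r, hr, by rw [mul_inv_cancel]; exact one_mem _⟩
  refine stronglyEmbedded_map T ?_ ?_ f hsurj ?_ ?_ ?_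
  · intro t ht
    exact h.of_mem hRP ht
  · intro htop
    exact hbad (htop.symm ▸ mem_top _ : (⟨n, hn⟩ : normalizer (R : Set G)) ∈ h.stabilizer hRP)
  · intro x hx
    obtain ⟨q, hq, hxq⟩ := (hker _).mp hx
    have := h.mul_of_normalizer (le_normalizer hq) (h.of_mem hRP (hRP hq))
      (h.of_mem_centralizer hRP hxq)
    rwa [inv_mul_cancel_right] at this
  · intro hle
    refine hlt'.not_ge ?_
    rintro x ⟨hxP, hxN⟩
    obtain ⟨q, hq, hxq⟩ := (hker _).mp (hle (show (⟨x, hxN⟩ : normalizer (R : Set G)) ∈ T from hxP))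
    -- An element of `N_P(R)` in the kernel `R C_G(R)` lies in `R C_P(R) = R`, contrary to `R <
    -- N_P(R)`.
    have hc := hcen 1 (by simpa using hRP)
    rw [map_one, one_smul] at hc
    have := hc ⟨mul_mem hxP ((P : Subgroup G).inv_mem (hRP hq)), hxq⟩
    simpa using mul_mem this hq
  · intro A hAT hA m hm
    set A' := A.map (normalizer (R : Set G)).subtype with hA'
    have hAP : A' ≤ P := map_le_iff_le_comap.mpr hAT
    have hAR : ¬ A' ≤ R := fun hle => hA fun a ha =>
      hRker a (hle (mem_map_of_mem _ ha))
    have hmA : MulAut.conj (m : G) • A' ≤ (P : Subgroup G) := by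
      intro x hx
      obtain ⟨a, ha, hax⟩ := mem_conj_smul.mp hx
      have := hm (conj_mem_conj_smul (g := m) ha)
      change ((m * a * m⁻¹ : normalizer (R : Set G)) : G) ∈ P at this
      have hx' : x = (m : G) * a * (m : G)⁻¹ := by
        change (a : G) = _ at hax
        rw [hax]
        group
      rw [hx']
      exact this
    refine h.mono le_sup_left (ih (R ⊔ A') m (left_lt_sup.mpr hAR) (sup_le hRP hAP) ?_)
    rw [smul_sup, conj_smul_eq_self_iff.mpr m.2]
    exact sup_le hRP hmA

/-- **Alperin's fusion theorem**: fusion in a Sylow subgroup is controlled by its normalizer and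
by the normalizers of the essential subgroups. -/
theorem ConjClosed.of_essential (P : Sylow p G) (h : ConjClosed (P : Subgroup G) Good)
    (hess : ∀ Q : Subgroup (P : Subgroup G), (ofGroup (P : Subgroup G)).Essential p Q →
      ∀ g ∈ normalizer ((Q.map (P : Subgroup G).subtype : Subgroup G) : Set G),
        Good (Q.map (P : Subgroup G).subtype) g)
    (S : Subgroup G) (g : G) (hS : S ≤ P) (hg : MulAut.conj g • S ≤ (P : Subgroup G)) :
    Good S g := by
  -- Downward induction on the order of `S`.
  induction hk : Nat.card G - Nat.card S using Nat.strong_induction_on generalizing S g with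
  | _ k IH =>
  have ih : ∀ (T : Subgroup G) (g : G), Nat.card S < Nat.card T → T ≤ P → MulAut.conj g • T ≤ (P : Subgroup G) →
      Good T g := by
    intro T g hST hT hgT
    refine IH _ ?_ T g hT hgT rfl
    have := card_le_card_group T
    omega
  rcases hS.eq_or_lt with rfl | hlt
  · refine h.of_mem_normalizer (conj_smul_eq_self_iff.mp ?_)
    exact eq_of_le_of_card_ge hg (card_conj_smul _ g).ge
  -- `R` is a fully normalized conjugate of `S` in `P`.
  obtain ⟨x, hxP, hx⟩ := Set.exists_max_image {x : G | MulAut.conj x • S ≤ (P : Subgroup G)}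
    (fun x => Nat.card (P ⊓ normalizer ((MulAut.conj x • S : Subgroup G) : Set G) : Subgroup G))
    (Set.toFinite _) ⟨g, hg⟩
  set R := MulAut.conj x • S with hRdef
  have hRP : R ≤ P := hxP
  have hRcard : Nat.card R = Nat.card S := card_conj_smul S x
  have hfn : ∀ y : G, MulAut.conj y • R ≤ (P : Subgroup G) →
      Nat.card (P ⊓ normalizer ((MulAut.conj y • R : Subgroup G) : Set G) : Subgroup G) ≤
      Nat.card (P ⊓ normalizer (R : Set G) : Subgroup G) := by
    intro y hy
    have := hx (y * x) (by rwa [Set.mem_ofPred_eq, conj_mul_smul])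
    simpa only [conj_mul_smul] using this
  have hcard := fun T => card_le_card_inf_normalizer (T := T) P hRP hfn
  have ltP : ∀ T ≤ (P : Subgroup G), Nat.card T = Nat.card S → T < P := by
    intro T hT hTS
    refine lt_of_le_of_ne hT ?_
    rintro rfl
    exact hlt.ne (eq_of_le_of_card_ge hS hTS.le)
  -- As `N_P(R)` is Sylow in `N_G(R)`, some `z` takes `U` to `R` and `N_P(U)` into `P`. It is good
  -- because `N_P(U) > U`.
  have toR : ∀ y : G, MulAut.conj y • R ≤ (P : Subgroup G) → ∃ z : G,
      MulAut.conj z • MulAut.conj y • R = R ∧ Good (MulAut.conj y • R) z ∧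
      MulAut.conj z • (P ⊓ normalizer ((MulAut.conj y • R : Subgroup G) : Set G) : Subgroup G) ≤
        (P : Subgroup G) := by
    intro y hy
    set U := MulAut.conj y • R with hU
    have hUcard : Nat.card U = Nat.card S := (card_conj_smul R y).trans hRcard
    obtain ⟨n, hn, hle⟩ := exists_conj_smul_le_of_card_le P.2.to_inf_left inf_le_right
      (isPGroup_conj_smul (P.2.to_inf_left (K := normalizer (U : Set G))) y⁻¹)
      ((conj_smul_mono inf_le_right _).trans
        (by rw [conj_smul_normalizer, hU, conj_inv_smul_smul])) hcard
    rw [← conj_mul_smul] at hle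
    have hlt' := lt_inf_normalizer_of_lt P.2 (ltP U hy hUcard)
    refine ⟨n * y⁻¹, ?_, ?_, hle.trans inf_le_left⟩
    · rw [conj_mul_smul, hU, conj_inv_smul_smul, conj_smul_eq_self_iff.mpr hn]
    · refine h.mono hlt'.le (ih _ _ ?_ inf_le_left (hle.trans inf_le_left))
      rw [← hUcard]
      exact Set.ncard_lt_ncard hlt'
  have ihR : ∀ T g, R < T → T ≤ P → MulAut.conj g • T ≤ (P : Subgroup G) → Good T g :=
    fun T g hRT => ih T g (hRcard ▸ Set.ncard_lt_ncard hRT)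
  have hRgood : ∀ n ∈ normalizer (R : Set G), Good R n := by
    intro n hn
    by_cases hcen : ∀ y : G, MulAut.conj y • R ≤ (P : Subgroup G) →
      (P ⊓ centralizer ((MulAut.conj y • R : Subgroup G) : Set G) : Subgroup G) ≤
        MulAut.conj y • R
    · have hmap := map_subtype_subgroupOf hRP
      have hltR := ltP R hRP hRcard
      generalize R.subgroupOf P = Q at hmap
      by_cases hQ : (ofGroup (P : Subgroup G)).Essential p Q
      · have := hess Q hQ
        rw [hmap] at this
        exact this n hn
      · rw [← hmap] at hltR hfn hcen ihR hn ⊢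
        exact h.of_not_essential P hltR hQ hfn hcen ihR hn
    · push Not at hcen
      obtain ⟨y, hy, hcy⟩ := hcen
      -- Were `C_P(R) ≤ R`, the map `z` would carry this inclusion back to the conjugate where it
      -- fails.
      refine h.of_centralizer_not_le P hRP hcard ihR (fun hle => hcy ?_) hn
      obtain ⟨z, hz, -, hzP⟩ := toR y hy
      rw [← pointwise_smul_le_pointwise_smul_iff (a := MulAut.conj z), hz]
      refine le_trans (le_inf ((conj_smul_mono ?_ z).trans hzP) ?_) hle
      · exact inf_le_inf_left _ (centralizer_le_normalizer _)
      · refine (conj_smul_mono inf_le_right z).trans ?_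
        rw [conj_smul_centralizer, hz]
  obtain ⟨z₁, hz₁, hgood₁, -⟩ := toR x⁻¹ (by rwa [hRdef, conj_inv_smul_smul])
  obtain ⟨z₂, hz₂, hgood₂, -⟩ := toR (g * x⁻¹) (by rwa [hRdef, conj_mul_smul, conj_inv_smul_smul])
  have hxR : MulAut.conj x⁻¹ • R = S := conj_inv_smul_smul S x
  rw [hxR] at hz₁ hgood₁
  have hgR : MulAut.conj (g * x⁻¹) • R = MulAut.conj g • S := by
    rw [hRdef, conj_mul_smul, conj_inv_smul_smul]
  rw [hgR] at hz₂ hgood₂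
  -- The map `g` factors as `z₂⁻¹ (z₂ g z₁⁻¹) z₁`, passing through `R`.
  have hn : z₂ * g * z₁⁻¹ ∈ normalizer (R : Set G) := by
    rw [← conj_smul_eq_self_iff]
    nth_rw 1 [← hz₁]
    rw [conj_mul_smul, conj_inv_smul_smul, conj_mul_smul, hz₂]
  have h1 : Good S (z₂ * g * z₁⁻¹ * z₁) := h.mul hgood₁ (hz₁.symm ▸ hRgood _ hn)
  have h2 := h.inv hgood₂
  rw [inv_mul_cancel_right] at h1
  have h3 : Good S (z₂⁻¹ * (z₂ * g)) := h.mul h1 (by rwa [conj_mul_smul])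
  rwa [inv_mul_cancel_left] at h3

end FusionSystem

/-- The quotient by `M` is simple and nilpotent, hence abelian. -/
theorem IsCoatom.commutator_le_of_isNilpotent {G : Type*} [Group G] [Group.IsNilpotent G]
    {M : Subgroup G} (hM : IsCoatom M) [M.Normal] : commutator G ≤ M := by
  have : Nontrivial (G ⧸ M) := QuotientGroup.nontrivial_iff.mpr hM.1
  have : IsSimpleGroup (G ⧸ M) :=
    { eq_bot_or_eq_top_of_normal := fun H _ => by
        have hMH : M ≤ H.comap (QuotientGroup.mk' M) := fun x hx => by
          rw [Subgroup.mem_comap, QuotientGroup.mk'_apply, (QuotientGroup.eq_one_iff x).mpr hx]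
          exact one_mem H
        have hmap := Subgroup.map_comap_eq_self_of_surjective (QuotientGroup.mk'_surjective M) H
        rcases hM.le_iff.mp hMH with h | h
        · right
          rw [← hmap, h, Subgroup.map_top_of_surjective _ (QuotientGroup.mk'_surjective M)]
        · left
          rw [← hmap, h, QuotientGroup.map_mk'_self] }
  rw [← Subgroup.Normal.quotient_commutative_iff_commutator_le]
  infer_instance

/-! ### Fusion when `N_G(P) = P C_G(P)`. -/

namespace FusionSystem

open Subgroup

variable {G : Type*} [Group G]

theorem exists_mul_inv_mem_centralizer {P : Subgroup G}
    (hN : normalizer (P : Set G) = P ⊔ centralizer (P : Set G)) {g : G}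
    (hg : g ∈ normalizer (P : Set G)) : ∃ x ∈ P, g * x⁻¹ ∈ centralizer (P : Set G) := by
  rw [hN, sup_comm, ← SetLike.mem_coe,
    coe_mul_of_left_le_normalizer_right _ _ (centralizer_le_normalizer _)] at hg
  obtain ⟨c, hc, x, hx, rfl⟩ := hg
  exact ⟨x, hx, by simpa using hc⟩

theorem exists_conj_eq_of_mem_normalizer {P : Subgroup G}
    (hN : normalizer (P : Set G) = P ⊔ centralizer (P : Set G)) {g : G}
    (hg : g ∈ normalizer (P : Set G)) : ∃ x ∈ P, ∀ s ∈ P, g * s * g⁻¹ = x * s * x⁻¹ := by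
  obtain ⟨x, hx, hc⟩ := exists_mul_inv_mem_centralizer hN hg
  refine ⟨x, hx, fun s hs => ?_⟩
  have := mem_centralizer_iff.mp hc _ (P.mul_mem (P.mul_mem hx hs) (P.inv_mem hx))
  rw [eq_mul_inv_iff_mul_eq.mpr this]
  group

variable {p : ℕ} [Fact p.Prime]

/-- Quantifying over `T ≤ S` gives stability under restriction. The bound `m` leaves only `T = S` to
check on an essential `S` of order `m`. -/
theorem conjClosed_conj {P : Subgroup G}
    (hN : normalizer (P : Set G) = P ⊔ centralizer (P : Set G)) (m : ℕ) :
    ConjClosed P fun S g => ∀ T ≤ S, m ≤ Nat.card T →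
      ∃ x ∈ P, MulAut.conj g • T = MulAut.conj x • T where
  mono := fun hTS h U hU => h U (hU.trans hTS)
  mul := fun {S g k} hg hk T hT hm => by
    obtain ⟨x, hx, hgx⟩ := hg T hT hm
    obtain ⟨y, hy, hky⟩ := hk (MulAut.conj g • T) (conj_smul_mono hT g)
      (by rwa [card_conj_smul])
    exact ⟨y * x, mul_mem hy hx, by rw [conj_mul_smul, hky, hgx, conj_mul_smul]⟩
  inv := fun {S g} hg T hT hm => by
    obtain ⟨x, hx, hgx⟩ := hg (MulAut.conj g⁻¹ • T)
      (by simpa only [conj_inv_smul_smul] using conj_smul_mono hT g⁻¹) (by rwa [card_conj_smul])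
    refine ⟨x⁻¹, inv_mem hx, ?_⟩
    rw [← conj_mul_smul, mul_inv_cancel, map_one, one_smul] at hgx
    nth_rw 2 [hgx]
    rw [conj_inv_smul_smul]
  of_mem_centralizer := fun {S g} _ hg T hT _ =>
    ⟨1, one_mem _, by
      rw [map_one, one_smul]
      exact conj_smul_eq_self_of_mem_centralizer (centralizer_le hT hg)⟩
  of_mem_normalizer := fun {g} hg T hT _ => by
    obtain ⟨x, hx, h⟩ := exists_conj_eq_of_mem_normalizer hN hg
    refine ⟨x, hx, ?_⟩
    have key : ∀ t ∈ T, MulAut.conj g • t = MulAut.conj x • t := fun t ht => h t (hT ht)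
    ext y
    rw [mem_smul_pointwise_iff_exists, mem_smul_pointwise_iff_exists]
    exact exists_congr fun t => and_congr_right fun ht => by rw [key t ht]

open scoped commutatorElement in
-- Elements of `N_G(P)` act on `P` as elements of `P`, so their commutators with `P` lie in `⁅P,
-- P⁆`.
theorem conjClosed_commutator {P M : Subgroup G}
    (hN : normalizer (P : Set G) = P ⊔ centralizer (P : Set G)) (hM : ⁅P, P⁆ ≤ M) :
    ConjClosed P fun S g => ∀ s ∈ S, ⁅s, g⁆ ∈ M where
  mono := fun hTS h s hs => h s (hTS hs)
  mul := fun {S g k} hg hk s hs => by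
    have h : ⁅s, k * g⁆ = ⁅s, g⁆ * ⁅g * s * g⁻¹, k⁆ := by
      simp only [commutatorElement_def]
      group
    rw [h]
    exact mul_mem (hg s hs) (hk _ (conj_mem_conj_smul hs))
  inv := fun {S g} hg s hs => by
    have h : ⁅s, g⁻¹⁆ = ⁅g⁻¹ * s * g, g⁆⁻¹ := by
      simp only [commutatorElement_def]
      group
    rw [h]
    exact inv_mem (hg _ (mem_conj_smul.mp hs))
  of_mem_centralizer := fun {S g} _ hg s hs => by
    rw [commutatorElement_eq_one_iff_mul_comm.mpr (mem_centralizer_iff.mp hg s hs)]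
    exact one_mem M
  of_mem_normalizer := fun {g} hg s hs => by
    obtain ⟨x, hx, h⟩ := exists_conj_eq_of_mem_normalizer hN hg
    have h2 : ⁅s, g⁆ = ⁅s, x⁆ := by
      have := h s⁻¹ (inv_mem hs)
      simp only [commutatorElement_def]
      rw [mul_assoc, mul_assoc, ← mul_assoc g, this]
      group
    rw [h2]
    exact hM (commutator_mem_commutator hs hx)

theorem Essential.ne_top {P : Subgroup G}
    (hN : normalizer (P : Set G) = P ⊔ centralizer (P : Set G)) {Q : Subgroup P}
    (hQ : (ofGroup P).Essential p Q) : Q ≠ ⊤ := by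
  rintro rfl
  obtain ⟨-, -, H, hp, -⟩ := hQ
  have hmap : (⊤ : Subgroup P).map P.subtype = P := by
    rw [← MonoidHom.range_eq_map, range_subtype]
  have hH : H = ⊥ := by
    rw [eq_bot_iff]
    intro y _
    obtain ⟨⟨n, hn'⟩, rfl⟩ := normalizerToOut_surjective _ y
    have hn := hn'
    rw [hmap] at hn
    obtain ⟨x, hx, hc⟩ := exists_mul_inv_mem_centralizer hN hn
    refine mem_ker_normalizerToOut.mpr ⟨x, ?_, ?_⟩
    · rwa [hmap]
    · change n * x⁻¹ ∈ _
      rwa [hmap]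
  rw [hH, card_bot] at hp
  exact Nat.Prime.one_lt Fact.out |>.ne' (Nat.dvd_one.mp hp)

theorem map_subtype_conj_smul {P : Subgroup G} (Q : Subgroup P) (x : P) :
    (MulAut.conj x • Q).map P.subtype = MulAut.conj (x : G) • Q.map P.subtype := by
  rw [conj_smul_eq_map, conj_smul_eq_map, map_map, map_map]
  rfl

/-- If all essential subgroups are isomorphic to `Q`, then they are conjugate to `Q` in `P`,
provided that `N_G(P) = P C_G(P)`. -/
theorem exists_conj_smul_eq_of_isomorphic [Finite G] (P : Sylow p G)
    (hN : normalizer ((P : Subgroup G) : Set G) =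
      (P : Subgroup G) ⊔ centralizer ((P : Subgroup G) : Set G))
    {Q : Subgroup (P : Subgroup G)}
    (hiso : ∀ R, (ofGroup (P : Subgroup G)).Essential p R →
      (ofGroup (P : Subgroup G)).Isomorphic Q R)
    {R : Subgroup (P : Subgroup G)} (hR : (ofGroup (P : Subgroup G)).Essential p R) :
    ∃ x : (P : Subgroup G), R = MulAut.conj x • Q := by
  obtain ⟨g, hg⟩ := ofGroup_isomorphic_iff.mp (hiso R hR)
  obtain ⟨x, hx, hgx⟩ := (conjClosed_conj hN
      (Nat.card (Q.map (P : Subgroup G).subtype))).of_essential P (fun E hE n hn T hT hcard => by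
    obtain ⟨k, hk⟩ := ofGroup_isomorphic_iff.mp (hiso E hE)
    rw [← card_conj_smul _ k, hk] at hcard
    rw [eq_of_le_of_card_ge hT hcard]
    exact ⟨1, one_mem _, by rw [conj_smul_eq_self_iff.mpr hn, map_one, one_smul]⟩)
    (Q.map (P : Subgroup G).subtype) g (map_subtype_le Q) (hg ▸ map_subtype_le R) _ le_rfl le_rfl
  refine ⟨⟨x, hx⟩, map_injective (subtype_injective _) ?_⟩
  rw [← hg, hgx, map_subtype_conj_smul]

/-- Maximal subgroups of a `p`-group are normal, so one above `Q` contains all `P`-conjugates of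
`Q`. Without essential subgroups any maximal subgroup serves. -/
theorem exists_isCoatom_forall_essential_le [Finite G] (P : Sylow p G)
    (hP : (P : Subgroup G) ≠ ⊥)
    (hN : normalizer ((P : Subgroup G) : Set G) =
      (P : Subgroup G) ⊔ centralizer ((P : Subgroup G) : Set G))
    (hiso : ∀ Q R, (ofGroup (P : Subgroup G)).Essential p Q →
      (ofGroup (P : Subgroup G)).Essential p R → (ofGroup (P : Subgroup G)).Isomorphic Q R) :
    ∃ M : Subgroup (P : Subgroup G), IsCoatom M ∧
      ∀ R, (ofGroup (P : Subgroup G)).Essential p R → R ≤ M := by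
  have hnil := P.2.isNilpotent
  by_cases h : ∃ Q, (ofGroup (P : Subgroup G)).Essential p Q
  · obtain ⟨Q, hQ⟩ := h
    obtain ⟨M, hM, hQM⟩ := (eq_top_or_exists_le_coatom Q).resolve_left (hQ.ne_top hN)
    have hMn : M.Normal :=
      Group.normalizerCondition_of_isNilpotent.normal_of_coatom M hM
    refine ⟨M, hM, fun R hR => ?_⟩
    obtain ⟨x, rfl⟩ := exists_conj_smul_eq_of_isomorphic P hN (fun E hE => hiso Q E hQ hE) hR
    exact (conj_smul_mono hQM x).trans (Normal.conj_smul_eq_self x M).le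
  · push Not at h
    have hbot : (⊥ : Subgroup (P : Subgroup G)) ≠ ⊤ := by
      have := nontrivial_iff_ne_bot _ |>.mpr hP
      exact bot_ne_top
    obtain ⟨M, hM, -⟩ := (eq_top_or_exists_le_coatom _).resolve_left hbot
    exact ⟨M, hM, fun R hR => (h R hR).elim⟩

end FusionSystem

theorem mainTheorem12 {G : Type*} [Group G] [Finite G] [Group.IsPerfect G]
    (p : ℕ) [Fact p.Prime] (P : Sylow p G) (hP : (P : Subgroup G) ≠ ⊥)
    (hN : Subgroup.normalizer ((P : Subgroup G) : Set G) =
      (P : Subgroup G) ⊔ Subgroup.centralizer ((P : Subgroup G) : Set G)) :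
    ∃ Q R : Subgroup (P : Subgroup G),
      (FusionSystem.ofGroup (P : Subgroup G)).Essential p Q ∧
      (FusionSystem.ofGroup (P : Subgroup G)).Essential p R ∧
      ¬ (FusionSystem.ofGroup (P : Subgroup G)).Isomorphic Q R := by
  by_contra! hiso
  obtain ⟨M, hM, hle⟩ := FusionSystem.exists_isCoatom_forall_essential_le P hP hN hiso
  have hnil := P.2.isNilpotent
  have hMn : M.Normal :=
    Subgroup.NormalizerCondition.normal_of_coatom M
      Group.normalizerCondition_of_isNilpotent hM
  have hcomm : ⁅(P : Subgroup G), (P : Subgroup G)⁆ ≤ M.map (P : Subgroup G).subtype := by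
    rw [← Subgroup.map_subtype_commutator]
    exact Subgroup.map_mono hM.commutator_le_of_isNilpotent
  have hgood := (FusionSystem.conjClosed_commutator hN hcomm).of_essential P
    fun E hE g hg s hs => by
      -- `⁅s, g⁆ = s · g s⁻¹ g⁻¹` already lies in `E`, since `g` normalizes `E`.
      refine Subgroup.map_mono (hle E hE) ?_
      rw [commutatorElement_def, mul_assoc, mul_assoc, ← mul_assoc g]
      exact mul_mem hs ((Subgroup.mem_normalizer_iff.mp hg _).mp (inv_mem hs))
  have hfocal : (P : Subgroup G).focalSubgroup ≤ M.map (P : Subgroup G).subtype := by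
    rw [Subgroup.focalSubgroup_def, Subgroup.closure_le]
    rintro _ ⟨hxu, x, hx, u, rfl⟩
    -- Fusion of a single element is fusion of the cyclic group it generates.
    refine hgood (Subgroup.zpowers x) u (Subgroup.zpowers_le.mpr hx) ?_ x
      (Subgroup.mem_zpowers x)
    rw [Subgroup.pointwise_smul_subset_iff, Subgroup.zpowers_le,
      Subgroup.mem_inv_pointwise_smul_iff]
    have := (P : Subgroup G).mul_mem ((P : Subgroup G).inv_mem hxu) hx
    rw [commutatorElement_def] at this
    change u * x * u⁻¹ ∈ (P : Subgroup G)
    simpa [mul_assoc] using this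
  rw [← Subgroup.commutator_inf_eq_focalSubgroup, Group.IsPerfect.commutator_eq_top,
    top_inf_eq] at hfocal
  apply hM.1
  rw [eq_top_iff]
  intro x _
  exact (Subgroup.mem_map_iff_mem (Subgroup.subtype_injective _)).mp (hfocal x.2)
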